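/- Let $\mathcal A=\{A_1,\dots,A_m\}$ be an irreducible finite family of real $d\times d$ matrices (no common nontrivial invariant subspace). Let $\Pi_1,\dots,\Pi_r$ ($r\ge 1$) be products of matrices of $\mathcal A$, of lengths $n_1,\dots,n_r\ge 1$, given by words that are simple (not powers of shorter words) and different up to cyclic permutations, such that all numbers $[\rho(\Pi_j)]^{1/n_j}$ are equal to one number $\rho_c$, where $\rho(\cdot)$ is the spectral radius. Put $\tilde{\mathcal A}=\rho_c^{-1}\mathcal A$, $\tilde A_i=\rho_c^{-1}A_i$, let $\tilde\Pi_j=\tilde A_{d_{n_j}}\cdots\tilde A_{d_1}$ be the corresponding products ($d_l=d_l^{(j)}$), and assume that $\tilde\Pi_j$ has the leading eigenvalue $1$, with an eigenvector $v_j\neq 0$. The root $\mathcal H_j$ is the cycle of vertices $v_j^{(1)}=v_j$, $v_j^{(l+1)}=\tilde A_{d_l}v_j^{(l)}$, $l=1,\dots,n_j-1$. Let $\alpha_1,\dots,\alpha_r>0$ be balancing multipliers and let $x_1,\dots,x_s\in\mathbb R^d$. The invariant polytope algorithm with the roots $\alpha_1\mathcal H_1,\dots,\alpha_r\mathcal H_r$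 and the extra initial vertices $x_1,\dots,x_s$ ($s\ge 0$) builds finite sets of vertices of a tree (a vertex is an initial vertex together with the word of the matrices applied to it; vertices with equal vectors are not identified): $\mathcal V_0=\mathcal R_0$ consists of the vertices of the roots $\alpha_j\mathcal H_j$ and of the vertices $x_i$; in the $k$-th iteration, $k\ge1$, it starts with $\mathcal V_k=\mathcal V_{k-1}$, $\mathcal R_k=\emptyset$ and examines, in any order, all pairs $(u,i)$, $u\in\mathcal R_{k-1}$, $1\le i\le m$, except for the edges $v_j^{(l)}\mapsto \tilde A_{d_l}v_j^{(l)}$ inside the roots ($1\le l\le n_j$), which lead to vertices of the same root. The new vertex $\tilde A_iu$ is added to both $\mathcal V_k$ and $\mathcal R_k$ unless it is an interior point of $\mathrm{co}(\mathcal V_k\cup-\mathcal V_k)$ for the current $\mathcal V_k$. The algorithm terminates if $\mathcal R_k=\emptyset$ for some $k$. Suppose that the algorithm without extra initial vertices terminates within finite time (for some order of examination). Then for each $j$ there is a unique vector $v_j^*$ with $\tilde\Pi_j^{T}v_j^*=v_j^*$ and $(v_j^*,v_j)=1$; and the algorithm with the extra initial vertices $x_1,\dots,x_s$ (for any order of examination)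 terminates within finite time if and only if $$q_j(x_i)<\alpha_j\qquad\text{for all } j=1,\dots,r,\ i=1,\dots,s,$$ where $q_j(x)=\sup\{\,|(v_j^*,\tilde\Pi x)| : \tilde\Pi\in\tilde{\mathcal A}^p,\ p\ge0\}\in[0,\infty]$. In particular, if the roots $\mathcal H_j$ are not multiplied (all $\alpha_j=1$), the condition is $q_j(x_i)<1$ for all $i,j$. -/

import Mathlib

open scoped Matrix

noncomputable section

namespace InvariantPolytope

/-- The spectral radius of a real matrix: the largest modulus of its complex eigenvalues. -/
def specRad {d : ℕ} (M : Matrix (Fin d) (Fin d) ℝ) : ℝ :=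
  (spectralRadius ℂ (M.map Complex.ofReal)).toReal

/-- The product of the matrices of a family along a word `[b₁, …, bₙ]`, the first letter being
applied first: `A bₙ * ⋯ * A b₁`. The empty word gives the identity matrix. -/
def wordProd {d m : ℕ} (A : Fin m → Matrix (Fin d) (Fin d) ℝ) (w : List (Fin m)) :
    Matrix (Fin d) (Fin d) ℝ :=
  (w.reverse.map A).prod

/-- The matrices of the family have no common nontrivial invariant subspace. -/
def IsIrreducibleFamily {d m : ℕ} (A : Fin m → Matrix (Fin d) (Fin d) ℝ) : Prop :=
  ∀ W : Submodule ℝ (Fin d → ℝ), (∀ i, ∀ y ∈ W, A i *ᵥ y ∈ W) → W = ⊥ ∨ W = ⊤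

/-- A (nonempty) word is simple if it is not a power of a shorter word. -/
def IsSimpleWord {m : ℕ} (w : List (Fin m)) : Prop :=
  w ≠ [] ∧ ∀ (u : List (Fin m)) (k : ℕ), u.length < w.length → w ≠ (List.replicate k u).flatten

/-- The normalized family `ρc⁻¹ A`. -/
def normalized {d m : ℕ} (ρc : ℝ) (A : Fin m → Matrix (Fin d) (Fin d) ℝ) :
    Fin m → Matrix (Fin d) (Fin d) ℝ :=
  fun i => ρc⁻¹ • A i

/-- The symmetrized convex hull `co (S ∪ -S)`. -/
def absco {d : ℕ} (S : Set (Fin d → ℝ)) : Set (Fin d → ℝ) :=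
  convexHull ℝ (S ∪ (fun y => -y) '' S)

/-- `w` is the adjoint leading eigenvector of the matrix `M` (with leading eigenvalue `1`) normalized
against the leading eigenvector `v`: `Mᵀ w = w` and `(w, v) = 1`. -/
def IsAdjointEigenvector {d : ℕ} (M : Matrix (Fin d) (Fin d) ℝ) (v w : Fin d → ℝ) : Prop :=
  Mᵀ *ᵥ w = w ∧ w ⬝ᵥ v = 1

/-- The supremum of `|(w, Π y)|` over all products `Π` (of all lengths `p ≥ 0`) of matrices of the
family `B`, as an extended nonnegative real. -/
def q {d m : ℕ} (B : Fin m → Matrix (Fin d) (Fin d) ℝ) (w y : Fin d → ℝ) : ENNReal :=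
  ⨆ u : List (Fin m), ENNReal.ofReal |w ⬝ᵥ (wordProd B u *ᵥ y)|

/-- The starting vertices of the algorithm for the words `P 0, …, P (r - 1)` and `s` extra initial
vertices: the vertex `Sum.inl ⟨j, l⟩` is the `l`-th element (counted from zero) of the `j`-th root,
the vertex `Sum.inr i` is the `i`-th extra vertex. -/
abbrev Start {m r : ℕ} (P : Fin r → List (Fin m)) (s : ℕ) : Type :=
  (Σ j : Fin r, Fin (P j).length) ⊕ Fin s

/-- The vertices of the tree of the algorithm: a starting vertex followed by the word of the letters
applied to it so far (first letter first). -/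
abbrev Node {m r : ℕ} (P : Fin r → List (Fin m)) (s : ℕ) : Type :=
  Start P s × List (Fin m)

/-- The data on which the algorithm runs: a (normalized) family `B`, the words `P j`, their leading
eigenvectors `v j`, the balancing multipliers `α j` and the extra initial vertices `x i`. -/
structure Input (d m r s : ℕ) where
  B : Fin m → Matrix (Fin d) (Fin d) ℝ
  P : Fin r → List (Fin m)
  v : Fin r → Fin d → ℝ
  α : Fin r → ℝ
  x : Fin s → Fin d → ℝ

namespace Input

variable {d m r s : ℕ}

/-- The vector at a starting vertex. If `P j = [d₁, …, dₙ]`, then the `j`-th root consists of the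
vectors `v`, `B d₁ v`, …, `B dₙ₋₁ ⋯ B d₁ v` for `v = v j`, and it is multiplied by `α j`. -/
def startVec (I : Input d m r s) : Start I.P s → Fin d → ℝ
  | Sum.inl ⟨j, l⟩ => I.α j • (wordProd I.B ((I.P j).take l) *ᵥ I.v j)
  | Sum.inr i => I.x i

/-- The point of `ℝ^d` at a vertex of the tree. -/
def vec (I : Input d m r s) (n : Node I.P s) : Fin d → ℝ :=
  wordProd I.B n.2 *ᵥ I.startVec n.1

/-- The edges of the tree inside a root: the `l`-th letter of `P j` takes the `l`-th element of the
`j`-th root to the next element of the same root (cyclically), so it creates no new vertex. -/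
def IsRootEdge (I : Input d m r s) (n : Node I.P s) (a : Fin m) : Prop :=
  ∃ (j : Fin r) (l : Fin (I.P j).length), n = (Sum.inl ⟨j, l⟩, []) ∧ a = (I.P j).get l

/-- The polytope spanned by a finite set of vertices of the tree. -/
def polytope (I : Input d m r s) (V : Finset (Node I.P s)) : Set (Fin d → ℝ) :=
  absco (I.vec '' (V : Set (Node I.P s)))

open Classical in
/-- The body of the inner loop: the pair `(n, a)` is examined, with current sets `(V, R)`. Edges
inside a root create nothing; otherwise the child of `n` along `a` is omitted if its point is interior
to the current polytope, and is added to both sets if not. -/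
def examine (I : Input d m r s) (VR : Finset (Node I.P s) × Finset (Node I.P s))
    (p : Node I.P s × Fin m) : Finset (Node I.P s) × Finset (Node I.P s) :=
  if I.IsRootEdge p.1 p.2 ∨ I.B p.2 *ᵥ I.vec p.1 ∈ interior (I.polytope VR.1) then VR
  else (insert (p.1.1, p.1.2 ++ [p.2]) VR.1, insert (p.1.1, p.1.2 ++ [p.2]) VR.2)

/-- The initial set of vertices: all elements of all roots and all extra vertices. -/
def initial (I : Input d m r s) : Finset (Node I.P s) :=
  Finset.univ.map ⟨fun σ : Start I.P s => (σ, ([] : List (Fin m))), fun _ _ h => (Prod.mk.inj h).1⟩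

/-- `V k`, `R k` are the sets of vertices and of new vertices after the `k`-th iteration of the
algorithm. In each iteration all pairs (new vertex of the previous iteration, letter) are examined
once, in any order. -/
def IsRun (I : Input d m r s) (V R : ℕ → Finset (Node I.P s)) : Prop :=
  V 0 = I.initial ∧ R 0 = I.initial ∧
    ∀ k, ∃ L : List (Node I.P s × Fin m), L.Nodup ∧ (∀ p, p ∈ L ↔ p.1 ∈ R k) ∧
      (V (k + 1), R (k + 1)) = L.foldl I.examine (V k, ∅)

end Input

/-- A run of the algorithm halts: some iteration creates no new vertex. -/
def Halts {ν : Type} (R : ℕ → Finset ν) : Prop := ∃ k, R k = ∅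

end InvariantPolytope

end

open InvariantPolytope

/-!
The argument takes place on the final polytope `K` of a run that halts, in the norm given by the
gauge of `K`. Its vertex set `T` is *complete* (`Input.IsComplete`): every child of a vertex in `T` is
in `T`, or in the interior of `K`, or continues a root. Hence `K` is invariant under the family,
irreducibility makes it a neighbourhood of zero, and the family acts by contractions of the gauge.

Since the tree on `T` is finite, a path that leaves the roots is in the interior of `K` after boundedly
many steps. So a vertex stays outside the interior for a long time only if it belongs to a root and the
path turns around that root. As the words are simple and different up to rotation, different root
vertices have different infinite words; thus for every long word at most one vertex survives
(`Input.exists_survivor_length`).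

Applied to the powers of the `j`-th product, this shows that an eigenvector `w` of the adjoint product
for the eigenvalue `1` takes its maximal modulus over `T` at the first vertex `α j • v j` of the `j`-th
root and nowhere else (`Input.abs_dotProduct_vec_lt`). This yields existence and uniqueness of the
normalized adjoint eigenvector, and the bound by `α j` on `K`.

*Necessity.* If the run with extra vertices halts, the orbit of an extra vertex consists of finitely
many vertices of the tree, none of which is a root vertex, and of points in a fixed smaller multiple of
the polytope; at all of them the adjoint eigenvector is bounded away from `α j`
(`Input.q_lt_of_isComplete`).

*Sufficiency.* Let `K` come from the run without extra vertices, let `y` be a point of the orbit of an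
extra vertex outside the interior of `K`, and write `y` as a combination of the vertices in `T` whose
coefficients have total modulus equal to the gauge of `y`. If the adjoint eigenvectors are bounded by
`θ * α j` with `θ < 1` along the orbit, the coefficient of any root vertex carries at most the fraction
`(1 + θ) / 2` of the total (`Input.abs_coeff_root_le`). A long word shrinks all the other terms by a
fixed factor, so the gauge of `y` shrinks by a fixed factor too, and the orbit enters the interior of
`K` after a number of steps that does not depend on the path (`Input.exists_length_gauge_lt_one`). The
polytopes of the run with extra vertices eventually contain `K`, so this run creates no vertices of
large depth (`halts_of_bound`).
-/

namespace InvariantPolytope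

/-! ### Cyclic words -/

/-- The letter at position `i` of the infinite repetition of the word `P`, as an option: it is
`none` only for the empty word. -/
def cyclicLetter {β : Type*} (P : List β) (i : ℕ) : Option β :=
  P[i % P.length]?

theorem cyclicLetter_periodic {β : Type*} (P : List β) :
    Function.Periodic (cyclicLetter P) P.length := fun i => by
  simp [cyclicLetter]

theorem periodic_mod {β : Type*} {f : ℕ → β} {p n : ℕ} (hp : Function.Periodic f p)
    (hn : Function.Periodic f n) : Function.Periodic f (p % n) := fun i => by
  have h := hn.nat_mul (p / n) (i + p % n)
  rw [← h, ← hp i]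
  congr 1
  have := Nat.mod_add_div p n
  simp only [Nat.cast_id]
  rw [mul_comm]
  omega

theorem periodic_gcd {β : Type*} {f : ℕ → β} (p n : ℕ) :
    Function.Periodic f p → Function.Periodic f n → Function.Periodic f (p.gcd n) := by
  induction p, n using Nat.gcd.induction with
  | H0 n => intro _ h; simpa using h
  | H1 p n _ ih => intro h1 h2; rw [Nat.gcd_rec]; exact ih (periodic_mod h2 h1) h1

theorem getElem?_flatten_replicate {β : Type*} (u : List β) (k i : ℕ) (hi : i < k * u.length) :
    (List.replicate k u).flatten[i]? = cyclicLetter u i := by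
  induction k generalizing i with
  | zero => simp at hi
  | succ k ih =>
    rw [List.replicate_succ, List.flatten_cons]
    by_cases h : i < u.length
    · rw [List.getElem?_append_left h, cyclicLetter, Nat.mod_eq_of_lt h]
    · push Not at h
      rw [List.getElem?_append_right h, ih _ (by rw [Nat.succ_mul] at hi; omega), cyclicLetter,
        cyclicLetter, Nat.mod_eq_sub_mod h]

theorem IsSimpleWord.length_pos {m : ℕ} {P : List (Fin m)} (h : IsSimpleWord P) : 0 < P.length :=
  List.length_pos_iff.2 h.1

theorem IsSimpleWord.length_dvd_of_periodic {m : ℕ} {P : List (Fin m)} (h : IsSimpleWord P) {p : ℕ}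
    (hp : Function.Periodic (cyclicLetter P) p) : P.length ∣ p := by
  by_contra hnd
  set n := P.length with hn
  have hn0 : 0 < n := h.length_pos
  have hgn : p.gcd n ∣ n := Nat.gcd_dvd_right p n
  have hg : Function.Periodic (cyclicLetter P) (p.gcd n) :=
    periodic_gcd p n hp (cyclicLetter_periodic P)
  have hlt : p.gcd n < n := lt_of_le_of_ne (Nat.le_of_dvd hn0 hgn)
    fun e => hnd (e ▸ Nat.gcd_dvd_left p n)
  generalize p.gcd n = g at hgn hg hlt
  have hg0 : 0 < g := Nat.pos_of_dvd_of_pos hgn hn0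
  have hlen : (P.take g).length = g := by rw [List.length_take]; omega
  have hkg : n / g * g = n := Nat.div_mul_cancel hgn
  refine h.2 (P.take g) (n / g) (by omega) (List.ext_getElem? fun i => ?_)
  by_cases hi : i < n
  · rw [getElem?_flatten_replicate _ _ _ (by rw [hlen, hkg]; exact hi), cyclicLetter, hlen,
      List.getElem?_take_of_lt (Nat.mod_lt _ hg0)]
    have h1 := hg.map_mod_nat i
    rw [cyclicLetter, cyclicLetter, ← hn, Nat.mod_eq_of_lt hi,
      Nat.mod_eq_of_lt ((Nat.mod_lt _ hg0).trans hlt)] at h1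
    exact h1.symm
  · rw [List.getElem?_eq_none (by omega), List.getElem?_eq_none]
    simp only [List.length_flatten, List.map_replicate, List.sum_replicate, smul_eq_mul]
    rw [hlen, hkg]; omega

/-- If two cyclic words agree from some positions on, then each has the length of the other as a
period. -/
theorem cyclicLetter_periodic_of_shift {β : Type*} {P Q : List β} (hP : 0 < P.length) {l l' : ℕ}
    (h : ∀ k, cyclicLetter P (l + k) = cyclicLetter Q (l' + k)) {p : ℕ}
    (hp : Function.Periodic (cyclicLetter Q) p) : Function.Periodic (cyclicLetter P) p := fun i => by
  have key : ∀ i, cyclicLetter P i = cyclicLetter Q (l' + (i + (l * P.length - l))) := fun i => by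
    rw [← h, ← (cyclicLetter_periodic P).nat_mul l i]
    congr 1
    have := Nat.le_mul_of_pos_right l hP
    simp only [Nat.cast_id]
    omega
  rw [key, key i, ← hp (l' + (i + _))]
  congr 1
  ring

section

variable {m r : ℕ} {P : Fin r → List (Fin m)}

/-- Different vertices of the roots have different infinite words: this is where it matters that the
words are simple and pairwise different up to rotation. -/
theorem root_eq_of_cyclicLetter_eq (hs : ∀ j, IsSimpleWord (P j))
    (hd : ∀ i j, i ≠ j → ¬ (P i).IsRotated (P j)) (ρ τ : Σ j : Fin r, Fin (P j).length)
    (h : ∀ k, cyclicLetter (P ρ.1) (ρ.2 + k) = cyclicLetter (P τ.1) (τ.2 + k)) : ρ = τ := by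
  obtain ⟨j, l⟩ := ρ
  obtain ⟨j', l'⟩ := τ
  dsimp only at h
  have hn : (P j).length = (P j').length := Nat.dvd_antisymm
    ((hs j).length_dvd_of_periodic
      (cyclicLetter_periodic_of_shift (hs j).length_pos h (cyclicLetter_periodic _)))
    ((hs j').length_dvd_of_periodic
      (cyclicLetter_periodic_of_shift (hs j').length_pos (fun k => (h k).symm)
        (cyclicLetter_periodic _)))
  have hjj : j = j' := by
    by_contra hne
    refine hd j j' hne ?_
    have e : (P j).rotate l = (P j').rotate l' := by
      refine List.ext_getElem? fun k => ?_
      by_cases hk : k < (P j).length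
      · rw [List.getElem?_rotate hk, List.getElem?_rotate (hn ▸ hk)]
        simpa [cyclicLetter, add_comm] using h k
      · rw [List.getElem?_eq_none (by simpa using hk),
          List.getElem?_eq_none (by rw [List.length_rotate]; omega)]
    have h1 : (P j).IsRotated ((P j).rotate l) := ⟨l, rfl⟩
    have h2 : (P j').IsRotated ((P j').rotate l') := ⟨l', rfl⟩
    exact h1.trans (e ▸ h2.symm)
  subst hjj
  have aux : ∀ a b : Fin (P j).length, a ≤ b →
      (∀ k, cyclicLetter (P j) (a + k) = cyclicLetter (P j) (b + k)) → a = b := by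
    intro a b hab hh
    have hp : Function.Periodic (cyclicLetter (P j)) (b - a : ℕ) := by
      intro i
      have h1 := hh (i + (a * (P j).length - a))
      have h2 := Nat.le_mul_of_pos_right (a : ℕ) (hs j).length_pos
      have h3 : (a : ℕ) ≤ b := hab
      have e1 := (cyclicLetter_periodic (P j)).nat_mul a i
      have e2 := (cyclicLetter_periodic (P j)).nat_mul a (i + (b - a))
      simp only [Nat.cast_id] at e1 e2
      rw [← e1, ← e2]
      convert h1.symm using 2 <;> omega
    have h3 : (a : ℕ) ≤ b := hab
    have h4 := Nat.eq_zero_of_dvd_of_lt ((hs j).length_dvd_of_periodic hp) (by omega)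
    exact Fin.ext (by omega)
  rcases le_total l l' with hl | hl
  · rw [aux l l' hl h]
  · rw [aux l' l hl fun k => (h k).symm]

theorem exists_separating_length (hs : ∀ j, IsSimpleWord (P j))
    (hd : ∀ i j, i ≠ j → ¬ (P i).IsRotated (P j)) :
    ∃ N : ℕ, ∀ ρ τ : Σ j : Fin r, Fin (P j).length, ρ ≠ τ →
      ∃ k < N, cyclicLetter (P ρ.1) (ρ.2 + k) ≠ cyclicLetter (P τ.1) (τ.2 + k) := by
  have h : ∀ ρ τ : Σ j : Fin r, Fin (P j).length, ρ ≠ τ →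
      ∃ k, cyclicLetter (P ρ.1) (ρ.2 + k) ≠ cyclicLetter (P τ.1) (τ.2 + k) := by
    intro ρ τ hne
    by_contra! hh
    exact hne (root_eq_of_cyclicLetter_eq hs hd ρ τ hh)
  choose! f hf using h
  refine ⟨(Finset.univ.sup fun ρ => Finset.univ.sup fun τ => f ρ τ) + 1, fun ρ τ hne =>
    ⟨f ρ τ, Nat.lt_succ_of_le ?_, hf ρ τ hne⟩⟩
  exact (Finset.le_sup (f := fun τ => f ρ τ) (Finset.mem_univ τ)).trans
    (Finset.le_sup (f := fun ρ => Finset.univ.sup fun τ => f ρ τ) (Finset.mem_univ ρ))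

end

/-! ### Runs of the algorithm -/

theorem wordProd_cons {d m : ℕ} (B : Fin m → Matrix (Fin d) (Fin d) ℝ) (a : Fin m)
    (u : List (Fin m)) : wordProd B (a :: u) = wordProd B u * B a := by
  simp [wordProd]

theorem wordProd_append {d m : ℕ} (B : Fin m → Matrix (Fin d) (Fin d) ℝ) (w u : List (Fin m)) :
    wordProd B (w ++ u) = wordProd B u * wordProd B w := by
  simp [wordProd]

theorem wordProd_nil {d m : ℕ} (B : Fin m → Matrix (Fin d) (Fin d) ℝ) : wordProd B [] = 1 := rfl

theorem wordProd_replicate_flatten {d m : ℕ} (B : Fin m → Matrix (Fin d) (Fin d) ℝ)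
    (u : List (Fin m)) (k : ℕ) :
    wordProd B (List.replicate k u).flatten = wordProd B u ^ k := by
  induction k with
  | zero => simp [wordProd_nil]
  | succ k ih => rw [List.replicate_succ, List.flatten_cons, wordProd_append, ih, pow_succ]

theorem absco_eq_absConvexHull {d : ℕ} (S : Set (Fin d → ℝ)) : absco S = absConvexHull ℝ S := by
  rw [absco, Set.image_neg_eq_neg, convexHull_union_neg_eq_absConvexHull]

theorem absco_mono {d : ℕ} {S S' : Set (Fin d → ℝ)} (h : S ⊆ S') : absco S ⊆ absco S' :=
  convexHull_mono (Set.union_subset_union h (Set.image_mono h))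

theorem subset_absco {d : ℕ} (S : Set (Fin d → ℝ)) : S ⊆ absco S :=
  Set.subset_union_left.trans (subset_convexHull ℝ _)

theorem convex_absco {d : ℕ} (S : Set (Fin d → ℝ)) : Convex ℝ (absco S) := convex_convexHull ℝ _

theorem neg_mem_absco {d : ℕ} {S : Set (Fin d → ℝ)} {y : Fin d → ℝ} (hy : y ∈ absco S) :
    -y ∈ absco S := by
  rw [absco_eq_absConvexHull] at hy ⊢
  simpa using balanced_absConvexHull.neg_mem_iff.2 hy

/-- A linear map that sends `S` into the symmetrized hull of `S'` sends the symmetrized hull of `S`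
there as well. -/
theorem mulVec_mem_absco {d : ℕ} {S S' : Set (Fin d → ℝ)} {M : Matrix (Fin d) (Fin d) ℝ}
    (h : ∀ y ∈ S, M *ᵥ y ∈ absco S') {y : Fin d → ℝ} (hy : y ∈ absco S) : M *ᵥ y ∈ absco S' := by
  have hsub : absco S ⊆ M.mulVecLin ⁻¹' absco S' := by
    refine convexHull_min ?_ ((convex_absco S').linear_preimage M.mulVecLin)
    rintro z (hz | ⟨z, hz, rfl⟩)
    · exact h z hz
    · simpa [Matrix.mulVec_neg] using neg_mem_absco (h z hz)
  exact hsub hy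

namespace Input

variable {d m r s : ℕ} {I : Input d m r s}

theorem polytope_mono {V W : Finset (Node I.P s)} (h : V ⊆ W) : I.polytope V ⊆ I.polytope W :=
  absco_mono (Set.image_mono (by exact_mod_cast h))

theorem vec_mem_polytope {V : Finset (Node I.P s)} {n : Node I.P s} (h : n ∈ V) :
    I.vec n ∈ I.polytope V :=
  subset_absco _ ⟨n, h, rfl⟩

theorem vec_append (n : Node I.P s) (u : List (Fin m)) :
    I.vec (n.1, n.2 ++ u) = wordProd I.B u *ᵥ I.vec n := by
  simp [vec, wordProd_append, Matrix.mulVec_mulVec]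

theorem vec_append_singleton (n : Node I.P s) (a : Fin m) :
    I.vec (n.1, n.2 ++ [a]) = I.B a *ᵥ I.vec n := by
  rw [vec_append]; simp [wordProd]

theorem mem_initial (σ : Start I.P s) : (σ, []) ∈ I.initial := by
  exact Finset.mem_map.2 ⟨σ, Finset.mem_univ σ, rfl⟩

theorem examine_mono (VR : Finset (Node I.P s) × Finset (Node I.P s)) (p : Node I.P s × Fin m) :
    VR.1 ⊆ (I.examine VR p).1 ∧ VR.2 ⊆ (I.examine VR p).2 := by
  unfold examine
  split_ifs
  · exact ⟨subset_rfl, subset_rfl⟩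
  · exact ⟨Finset.subset_insert _ _, Finset.subset_insert _ _⟩

theorem foldl_examine_mono (L : List (Node I.P s × Fin m))
    (VR : Finset (Node I.P s) × Finset (Node I.P s)) :
    VR.1 ⊆ (L.foldl I.examine VR).1 ∧ VR.2 ⊆ (L.foldl I.examine VR).2 := by
  induction L generalizing VR with
  | nil => exact ⟨subset_rfl, subset_rfl⟩
  | cons p L ih =>
    exact ⟨(examine_mono VR p).1.trans (ih _).1, (examine_mono VR p).2.trans (ih _).2⟩

theorem foldl_examine_step (L : List (Node I.P s × Fin m))
    (VR : Finset (Node I.P s) × Finset (Node I.P s)) (p : Node I.P s × Fin m) (hp : p ∈ L) :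
    I.IsRootEdge p.1 p.2 ∨
      I.B p.2 *ᵥ I.vec p.1 ∈ interior (I.polytope (L.foldl I.examine VR).1) ∨
      (p.1.1, p.1.2 ++ [p.2]) ∈ (L.foldl I.examine VR).1 := by
  induction L generalizing VR with
  | nil => simp at hp
  | cons p' L ih =>
    rcases List.mem_cons.1 hp with rfl | hp
    · have hm := (foldl_examine_mono L (I.examine VR p)).1
      rw [List.foldl_cons]
      by_cases h : I.IsRootEdge p.1 p.2 ∨ I.B p.2 *ᵥ I.vec p.1 ∈ interior (I.polytope VR.1)
      · rcases h with h | h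
        · exact Or.inl h
        · exact Or.inr (Or.inl (interior_mono
            (polytope_mono ((examine_mono VR p).1.trans hm)) h))
      · refine Or.inr (Or.inr (hm ?_))
        rw [examine, if_neg h]
        exact Finset.mem_insert_self _ _
    · exact ih _ hp

theorem foldl_examine_new (L : List (Node I.P s × Fin m))
    (VR : Finset (Node I.P s) × Finset (Node I.P s)) (n : Node I.P s)
    (hn : n ∈ (L.foldl I.examine VR).2) :
    n ∈ VR.2 ∨ ∃ p ∈ L, n = (p.1.1, p.1.2 ++ [p.2]) ∧ ¬ I.IsRootEdge p.1 p.2 ∧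
      I.vec n ∉ interior (I.polytope VR.1) := by
  induction L generalizing VR with
  | nil => exact Or.inl hn
  | cons p L ih =>
    rcases ih _ hn with h | ⟨p', hp', e, h1, h2⟩
    · by_cases hc : I.IsRootEdge p.1 p.2 ∨ I.B p.2 *ᵥ I.vec p.1 ∈ interior (I.polytope VR.1)
      · rw [examine, if_pos hc] at h
        exact Or.inl h
      · rw [examine, if_neg hc] at h
        push Not at hc
        rcases Finset.mem_insert.1 h with rfl | h
        · exact Or.inr ⟨p, List.mem_cons_self, rfl, hc.1, by
            rw [vec_append_singleton]; exact hc.2⟩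
        · exact Or.inl h
    · exact Or.inr ⟨p', List.mem_cons_of_mem _ hp', e, h1, fun hh =>
        h2 (interior_mono (polytope_mono (examine_mono VR p).1) hh)⟩

theorem foldl_examine_fst_subset (L : List (Node I.P s × Fin m))
    (VR : Finset (Node I.P s) × Finset (Node I.P s)) (n : Node I.P s)
    (hn : n ∈ (L.foldl I.examine VR).1) : n ∈ VR.1 ∨ n ∈ (L.foldl I.examine VR).2 := by
  induction L generalizing VR with
  | nil => exact Or.inl hn
  | cons p L ih =>
    rcases ih _ hn with h | h
    · by_cases hc : I.IsRootEdge p.1 p.2 ∨ I.B p.2 *ᵥ I.vec p.1 ∈ interior (I.polytope VR.1)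
      · rw [examine, if_pos hc] at h
        exact Or.inl h
      · have hm := (foldl_examine_mono L (I.examine VR p)).2
        rw [examine, if_neg hc] at h hm
        rcases Finset.mem_insert.1 h with rfl | h
        · refine Or.inr ?_
          rw [List.foldl_cons, examine, if_neg hc]
          exact hm (Finset.mem_insert_self _ _)
        · exact Or.inl h
    · exact Or.inr h

/-- A finite set of vertices of the tree is complete if it contains all starting vertices and if
every child of its vertices is in the set, or lies in the interior of its polytope, or continues a
root. The final set of a run that halts is complete. -/
structure IsComplete (I : Input d m r s) (T : Finset (Node I.P s)) : Prop where
  start : ∀ σ, (σ, []) ∈ T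
  step : ∀ n ∈ T, ∀ a, I.IsRootEdge n a ∨ I.B a *ᵥ I.vec n ∈ interior (I.polytope T) ∨
    (n.1, n.2 ++ [a]) ∈ T

section Run

variable {V R : ℕ → Finset (Node I.P s)} (h : I.IsRun V R)

include h

theorem IsRun.subset_succ (k : ℕ) : V k ⊆ V (k + 1) := by
  obtain ⟨L, -, -, e⟩ := h.2.2 k
  have := (foldl_examine_mono L (V k, ∅)).1
  rwa [← e] at this

theorem IsRun.mono : Monotone V := monotone_nat_of_le_succ h.subset_succ

theorem IsRun.step (k : ℕ) (n : Node I.P s) (hn : n ∈ R k) (a : Fin m) :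
    I.IsRootEdge n a ∨ I.B a *ᵥ I.vec n ∈ interior (I.polytope (V (k + 1))) ∨
      (n.1, n.2 ++ [a]) ∈ V (k + 1) := by
  obtain ⟨L, -, hL, e⟩ := h.2.2 k
  have := foldl_examine_step L (V k, ∅) (n, a) ((hL _).2 hn)
  rwa [← e] at this

theorem IsRun.new (k : ℕ) (n : Node I.P s) (hn : n ∈ R (k + 1)) :
    ∃ n' ∈ R k, ∃ a, n = (n'.1, n'.2 ++ [a]) ∧ ¬ I.IsRootEdge n' a ∧
      I.vec n ∉ interior (I.polytope (V k)) := by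
  obtain ⟨L, -, hL, e⟩ := h.2.2 k
  have hn' : n ∈ (L.foldl I.examine (V k, ∅)).2 := by rw [← e]; exact hn
  rcases foldl_examine_new L (V k, ∅) n hn' with h0 | ⟨p, hp, e1, e2, e3⟩
  · simp at h0
  · exact ⟨p.1, (hL p).1 hp, p.2, e1, e2, e3⟩

theorem IsRun.exists_mem_new (k : ℕ) (n : Node I.P s) (hn : n ∈ V k) : ∃ l ≤ k, n ∈ R l := by
  induction k with
  | zero => exact ⟨0, le_rfl, by rw [h.2.1, ← h.1]; exact hn⟩
  | succ k ih =>
    obtain ⟨L, -, hL, e⟩ := h.2.2 k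
    have hn' : n ∈ (L.foldl I.examine (V k, ∅)).1 := by rw [← e]; exact hn
    rcases foldl_examine_fst_subset L (V k, ∅) n hn' with h0 | h0
    · obtain ⟨l, hl, hh⟩ := ih h0
      exact ⟨l, hl.trans k.le_succ, hh⟩
    · rw [← e] at h0
      exact ⟨k + 1, le_rfl, h0⟩

theorem IsRun.isComplete {k : ℕ} (hk : R k = ∅) : I.IsComplete (V k) where
  start σ := h.mono k.zero_le (by rw [h.1]; exact mem_initial σ)
  step n hn a := by
    obtain ⟨l, hl, hnl⟩ := h.exists_mem_new k n hn
    have hlk : l + 1 ≤ k := Nat.lt_of_le_of_ne hl (by rintro rfl; simp [hk] at hnl)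
    rcases h.step l n hnl a with h1 | h1 | h1
    · exact Or.inl h1
    · exact Or.inr (Or.inl (interior_mono (polytope_mono (h.mono hlk)) h1))
    · exact Or.inr (Or.inr (h.mono hlk h1))

/-- A vertex created in the `k`-th iteration carries a word of length `k`, and its first letter does
not continue a root. -/
theorem IsRun.length_eq (k : ℕ) (n : Node I.P s) (hn : n ∈ R k) :
    n.2.length = k ∧ ∀ a w, n.2 = a :: w → ¬ I.IsRootEdge (n.1, []) a := by
  induction k generalizing n with
  | zero =>
    rw [h.2.1] at hn
    obtain ⟨σ, -, rfl⟩ := Finset.mem_map.1 hn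
    exact ⟨rfl, fun a w e => by cases e⟩
  | succ k ih =>
    obtain ⟨⟨σ, w'⟩, hn', a, rfl, hr, -⟩ := h.new k n hn
    obtain ⟨h1, h2⟩ := ih _ hn'
    refine ⟨by simpa using h1, fun b w e => ?_⟩
    cases w' with
    | nil =>
      simp only [List.nil_append, List.cons.injEq] at e
      rw [← e.1]
      exact hr
    | cons c w' =>
      simp only [List.cons_append, List.cons.injEq] at e
      rw [← e.1]
      exact h2 c w' rfl

end Run

end Input

/-! ### The norm of a symmetric polytope -/

section Gauge

variable {d : ℕ} {ι : Type*} {T : Finset ι} {f : ι → Fin d → ℝ}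

open scoped Topology

theorem isClosed_absco_image : IsClosed (absco (f '' (T : Set ι))) := by
  have h : (f '' (T : Set ι)).Finite := T.finite_toSet.image f
  exact (h.union (h.image _)).isClosed_convexHull ℝ

theorem balanced_absco (S : Set (Fin d → ℝ)) : Balanced ℝ (absco S) := by
  rw [absco_eq_absConvexHull]; exact balanced_absConvexHull

theorem exists_sum_of_mem_absco {y : Fin d → ℝ} (hy : y ∈ absco (f '' (T : Set ι))) :
    ∃ c : ι → ℝ, y = ∑ n ∈ T, c n • f n ∧ ∑ n ∈ T, |c n| ≤ 1 := by
  classical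
  let C : Set (Fin d → ℝ) := {y | ∃ c : ι → ℝ, y = ∑ n ∈ T, c n • f n ∧ ∑ n ∈ T, |c n| ≤ 1}
  have hsub : absConvexHull ℝ (f '' (T : Set ι)) ⊆ C := by
    refine absConvexHull_min ?_ ⟨?_, ?_⟩
    · rintro _ ⟨n, hn, rfl⟩
      refine ⟨Pi.single n 1, ?_, ?_⟩
      · rw [Finset.sum_eq_single_of_mem n hn fun k _ hk => by simp [hk]]
        simp
      · rw [Finset.sum_eq_single_of_mem n hn fun k _ hk => by simp [hk]]
        simp
    · rintro t ht _ ⟨_, ⟨c, rfl, hc⟩, rfl⟩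
      refine ⟨fun n => t * c n, by simp [Finset.smul_sum, mul_smul], ?_⟩
      simp only [abs_mul, ← Finset.mul_sum]
      rw [Real.norm_eq_abs] at ht
      exact mul_le_one₀ ht (Finset.sum_nonneg fun _ _ => abs_nonneg _) hc
    · rintro _ ⟨c, rfl, hc⟩ _ ⟨c', rfl, hc'⟩ a b ha hb hab
      refine ⟨fun n => a * c n + b * c' n,
        by simp [Finset.smul_sum, mul_smul, add_smul, Finset.sum_add_distrib], ?_⟩
      calc ∑ n ∈ T, |a * c n + b * c' n| ≤ ∑ n ∈ T, (a * |c n| + b * |c' n|) := by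
            refine Finset.sum_le_sum fun n _ => (abs_add_le _ _).trans ?_
            rw [abs_mul, abs_mul, abs_of_nonneg ha, abs_of_nonneg hb]
        _ = a * ∑ n ∈ T, |c n| + b * ∑ n ∈ T, |c' n| := by
            rw [Finset.sum_add_distrib, Finset.mul_sum, Finset.mul_sum]
        _ ≤ a * 1 + b * 1 := by gcongr
        _ = 1 := by linarith
  rw [absco_eq_absConvexHull] at hy
  exact hsub hy

/-- The symmetrized hull of a finite spanning set is a neighbourhood of zero: it contains the image
of a small cube under an open linear map. -/
theorem absco_mem_nhds_zero (hT : T.Nonempty)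
    (hspan : Submodule.span ℝ (f '' (T : Set ι)) = ⊤) :
    absco (f '' (T : Set ι)) ∈ 𝓝 (0 : Fin d → ℝ) := by
  classical
  let φ : (T → ℝ) →ₗ[ℝ] (Fin d → ℝ) := Fintype.linearCombination ℝ (fun n : T => f n)
  have hφ : Function.Surjective φ := by
    rw [← LinearMap.range_eq_top, Fintype.range_linearCombination, ← hspan]
    congr 1
    ext y
    simp
  have hopen : IsOpenMap φ := LinearMap.isOpenMap_of_finiteDimensional φ hφ
  set N : ℝ := (T.card : ℝ) with hN
  have hNpos : 0 < N := Nat.cast_pos.2 hT.card_pos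
  have himg := hopen.image_mem_nhds (Metric.closedBall_mem_nhds (0 : T → ℝ) (inv_pos.2 hNpos))
  rw [map_zero] at himg
  refine Filter.mem_of_superset himg ?_
  rintro _ ⟨c, hc, rfl⟩
  -- the sum of the `N` terms is the mean of their multiples by `N`
  have e : φ c = ∑ n : T, N⁻¹ • ((N * c n) • f n) := by
    simp only [φ, Fintype.linearCombination_apply, smul_smul]
    refine Finset.sum_congr rfl fun n _ => ?_
    rw [inv_mul_cancel_left₀ hNpos.ne']
  rw [e]
  refine (convex_absco _).sum_mem (fun _ _ => (inv_pos.2 hNpos).le) ?_ fun n _ => ?_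
  · simp only [Finset.sum_const, Finset.card_univ, Fintype.card_coe, nsmul_eq_mul]
    exact mul_inv_cancel₀ hNpos.ne'
  · refine (balanced_absco _).smul_mem ?_ (subset_absco _ ⟨n, n.2, rfl⟩)
    have h1 : ‖c n‖ ≤ N⁻¹ := (norm_le_pi_norm c n).trans (by simpa using hc)
    rw [norm_mul, Real.norm_of_nonneg hNpos.le]
    calc N * ‖c n‖ ≤ N * N⁻¹ := by gcongr
      _ = 1 := mul_inv_cancel₀ hNpos.ne'

/-- A point outside the open unit ball of the gauge of the hull has a representation of the same
`ℓ¹` norm. -/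
theorem exists_sum_of_one_le_gauge (h0 : absco (f '' (T : Set ι)) ∈ 𝓝 (0 : Fin d → ℝ))
    {y : Fin d → ℝ} (hy : 1 ≤ gauge (absco (f '' (T : Set ι))) y) :
    ∃ c : ι → ℝ, y = ∑ n ∈ T, c n • f n ∧
      ∑ n ∈ T, |c n| ≤ gauge (absco (f '' (T : Set ι))) y := by
  set g := gauge (absco (f '' (T : Set ι))) y with hg
  have hpos : 0 < g := one_pos.trans_le hy
  have hmem : g⁻¹ • y ∈ absco (f '' (T : Set ι)) := by
    rw [← isClosed_absco_image.closure_eq, ← gauge_le_one_iff_mem_closure (convex_absco _) h0,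
      gauge_smul_of_nonneg (inv_nonneg.2 hpos.le), smul_eq_mul, ← hg, inv_mul_cancel₀ hpos.ne']
  obtain ⟨c, hc, hc1⟩ := exists_sum_of_mem_absco hmem
  refine ⟨fun n => g * c n, ?_, ?_⟩
  · rw [← inv_smul_smul₀ hpos.ne' y, smul_comm, hc, Finset.smul_sum]
    simp only [mul_smul]
  · simp only [abs_mul, ← Finset.mul_sum, abs_of_pos hpos]
    exact mul_le_of_le_one_right hpos.le hc1

end Gauge

/-- Finitely many numbers below one have a common bound in `[0, 1)`. -/
theorem exists_bound_lt_one {β : Type*} {S : Set β} (hS : S.Finite) (φ : β → ℝ)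
    (h : ∀ b ∈ S, φ b < 1) : ∃ c, 0 ≤ c ∧ c < 1 ∧ ∀ b ∈ S, φ b ≤ c := by
  induction S, hS using Set.Finite.induction_on with
  | empty => exact ⟨0, le_rfl, one_pos, by simp⟩
  | @insert a S _ _ ih =>
    obtain ⟨c, h0, h1, hc⟩ := ih fun b hb => h b (Set.mem_insert_of_mem _ hb)
    refine ⟨max c (φ a), le_max_of_le_left h0, max_lt h1 (h a (Set.mem_insert _ _)), ?_⟩
    rintro b (rfl | hb)
    · exact le_max_right _ _
    · exact (hc b hb).trans (le_max_left _ _)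

theorem gauge_mulVec_le {d : ℕ} {K : Set (Fin d → ℝ)} (hK : Absorbent ℝ K)
    {M : Matrix (Fin d) (Fin d) ℝ} (hM : ∀ y ∈ K, M *ᵥ y ∈ K) (y : Fin d → ℝ) :
    gauge K (M *ᵥ y) ≤ gauge K y := by
  refine le_of_forall_pos_le_add fun ε hε => ?_
  obtain ⟨b, hb, hlt, z, hz, rfl⟩ := exists_lt_of_gauge_lt hK (lt_add_of_pos_right (gauge K y) hε)
  refine (gauge_le_of_mem hb.le ⟨M *ᵥ z, hM z hz, ?_⟩).trans hlt.le
  simp [Matrix.mulVec_smul]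

/-- A functional bounded by `c` on a symmetric hull is bounded by `c` times its gauge. -/
theorem abs_dotProduct_le_mul_gauge {d : ℕ} {ι : Type*} {T : Finset ι} {f : ι → Fin d → ℝ}
    (hK : Absorbent ℝ (absco (f '' (T : Set ι)))) {w : Fin d → ℝ} {c : ℝ} (hc0 : 0 ≤ c)
    (hc : ∀ n ∈ T, |w ⬝ᵥ f n| ≤ c) (y : Fin d → ℝ) :
    |w ⬝ᵥ y| ≤ c * gauge (absco (f '' (T : Set ι))) y := by
  have h1 : ∀ z ∈ absco (f '' (T : Set ι)), |w ⬝ᵥ z| ≤ c := by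
    intro z hz
    obtain ⟨a, rfl, ha⟩ := exists_sum_of_mem_absco hz
    rw [dotProduct_sum]
    refine (Finset.abs_sum_le_sum_abs _ _).trans ?_
    calc ∑ n ∈ T, |w ⬝ᵥ a n • f n| ≤ ∑ n ∈ T, |a n| * c := by
          refine Finset.sum_le_sum fun n hn => ?_
          rw [dotProduct_smul, smul_eq_mul, abs_mul]
          exact mul_le_mul_of_nonneg_left (hc n hn) (abs_nonneg _)
      _ = (∑ n ∈ T, |a n|) * c := by rw [Finset.sum_mul]
      _ ≤ 1 * c := by gcongr
      _ = c := one_mul c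
  refine le_of_forall_pos_le_add fun ε hε => ?_
  have hε' : 0 < ε / (c + 1) := by positivity
  obtain ⟨b, hb, hlt, z, hz, rfl⟩ := exists_lt_of_gauge_lt hK
    (lt_add_of_pos_right (gauge (absco (f '' (T : Set ι))) y) hε')
  simp only at hlt ⊢
  rw [dotProduct_smul, smul_eq_mul, abs_mul, abs_of_pos hb]
  have h2 : c * (ε / (c + 1)) ≤ ε := by
    rw [mul_div_assoc', div_le_iff₀ (by positivity)]
    nlinarith
  calc b * |w ⬝ᵥ z| ≤ b * c := mul_le_mul_of_nonneg_left (h1 z hz) hb.le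
    _ ≤ (gauge (absco (f '' (T : Set ι))) (b • z) + ε / (c + 1)) * c := by gcongr
    _ = c * gauge (absco (f '' (T : Set ι))) (b • z) + c * (ε / (c + 1)) := by ring
    _ ≤ _ := by gcongr

theorem gauge_sum_smul_le {d : ℕ} {ι : Type*} {K : Set (Fin d → ℝ)} (hK : Absorbent ℝ K)
    (hc : Convex ℝ K) (hb : Balanced ℝ K) (T : Finset ι) (c : ι → ℝ) (f : ι → Fin d → ℝ) :
    gauge K (∑ n ∈ T, c n • f n) ≤ ∑ n ∈ T, |c n| * gauge K (f n) := by
  refine (gauge_sum_le hc hK T _).trans (le_of_eq (Finset.sum_congr rfl fun n _ => ?_))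
  rw [gauge_smul hb, Real.norm_eq_abs]

namespace Input

variable {d m r s : ℕ} {I : Input d m r s}

/-! ### The dynamics on a complete set of vertices -/

/-- The hypotheses on the input of the algorithm, for the normalized family: it is irreducible, the
words are simple and pairwise different up to rotation, and `v j` is an eigenvector of the `j`-th
product for the eigenvalue `1`. -/
structure Admissible (I : Input d m r s) : Prop where
  r_pos : 0 < r
  irreducible : IsIrreducibleFamily I.B
  simple : ∀ j, IsSimpleWord (I.P j)
  not_isRotated : ∀ i j, i ≠ j → ¬ (I.P i).IsRotated (I.P j)
  v_ne_zero : ∀ j, I.v j ≠ 0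
  eigen : ∀ j, wordProd I.B (I.P j) *ᵥ I.v j = I.v j
  α_pos : ∀ j, 0 < I.α j

/-- The vectors of the `j`-th root, continued periodically. -/
def rootVec (I : Input d m r s) (j : Fin r) (i : ℕ) : Fin d → ℝ :=
  I.α j • (wordProd I.B ((I.P j).take (i % (I.P j).length)) *ᵥ I.v j)

theorem vec_root (j : Fin r) (l : Fin (I.P j).length) :
    I.vec (Sum.inl ⟨j, l⟩, []) = I.rootVec j l := by
  simp [vec, rootVec, startVec, wordProd_nil, Nat.mod_eq_of_lt l.2]

theorem rootVec_zero (j : Fin r) : I.rootVec j 0 = I.α j • I.v j := by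
  simp [rootVec, wordProd_nil]

theorem isRootEdge_iff (j : Fin r) (l : Fin (I.P j).length) (a : Fin m) :
    I.IsRootEdge (Sum.inl ⟨j, l⟩, []) a ↔ cyclicLetter (I.P j) l = some a := by
  have e : cyclicLetter (I.P j) l = some ((I.P j).get l) := by
    simp [cyclicLetter, Nat.mod_eq_of_lt l.2]
  rw [e, Option.some_inj]
  constructor
  · rintro ⟨j', l', h, rfl⟩
    simp only [Prod.mk.injEq, Sum.inl.injEq, and_true] at h
    cases h
    rfl
  · rintro rfl
    exact ⟨j, l, rfl, rfl⟩

theorem mulVec_rootVec (hI : I.Admissible) {j : Fin r} {i : ℕ} {a : Fin m}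
    (h : cyclicLetter (I.P j) i = some a) : I.B a *ᵥ I.rootVec j i = I.rootVec j (i + 1) := by
  have hn := (hI.simple j).length_pos
  set n := (I.P j).length with hn'
  have hl : i % n < n := Nat.mod_lt _ hn
  have ht : (I.P j).take (i % n + 1) = (I.P j).take (i % n) ++ [a] := by
    rw [List.take_add_one, show (I.P j)[i % n]? = some a from h]
    rfl
  have e : I.B a *ᵥ I.rootVec j i =
      I.α j • (wordProd I.B ((I.P j).take (i % n + 1)) *ᵥ I.v j) := by
    rw [ht, wordProd_append, rootVec, Matrix.mulVec_smul, Matrix.mulVec_mulVec]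
    simp [wordProd, n]
  rw [e, rootVec, ← hn']
  by_cases hlt : i % n + 1 < n
  · rw [Nat.add_mod i 1 n, Nat.mod_eq_of_lt (by omega : 1 < n), Nat.mod_eq_of_lt hlt]
  · have h1 : i % n + 1 = n := by omega
    have h2 : (i + 1) % n = 0 := by
      rw [← Nat.mod_add_mod, h1, Nat.mod_self]
    rw [h1, h2, hn', List.take_length, hI.eigen j]
    simp [wordProd_nil]

section Complete

variable (hI : I.Admissible) {T : Finset (Node I.P s)} (hT : I.IsComplete T)

include hI

theorem rootVec_mem_polytope (hT : ∀ σ, (σ, []) ∈ T) (j : Fin r) (i : ℕ) :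
    I.rootVec j i ∈ I.polytope T := by
  have h := vec_mem_polytope (hT (Sum.inl ⟨j, ⟨i % _, Nat.mod_lt i (hI.simple j).length_pos⟩⟩))
  rw [vec_root] at h
  simpa [rootVec] using h

theorem mulVec_mem_of_isRootEdge (hT : ∀ σ, (σ, []) ∈ T) {n : Node I.P s} {a : Fin m}
    (h : I.IsRootEdge n a) : I.B a *ᵥ I.vec n ∈ I.polytope T := by
  have h' := h
  obtain ⟨j, l, rfl, -⟩ := h
  rw [isRootEdge_iff] at h'
  rw [vec_root, mulVec_rootVec hI h']
  exact rootVec_mem_polytope hI hT j _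

include hT

theorem mulVec_mem_polytope (a : Fin m) {y : Fin d → ℝ} (hy : y ∈ I.polytope T) :
    I.B a *ᵥ y ∈ I.polytope T := by
  refine mulVec_mem_absco ?_ hy
  rintro _ ⟨n, hn, rfl⟩
  rcases hT.step n hn a with h | h | h
  · exact mulVec_mem_of_isRootEdge hI hT.start h
  · exact interior_subset h
  · have := vec_mem_polytope h
    rwa [vec_append_singleton] at this

/-- The polytope of a complete set is a neighbourhood of zero: its linear span is an invariant
subspace of the irreducible family. -/
theorem polytope_mem_nhds_zero : I.polytope T ∈ nhds (0 : Fin d → ℝ) := by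
  have hj : (0 : ℕ) < r := hI.r_pos
  let j : Fin r := ⟨0, hj⟩
  let n₀ : Node I.P s := (Sum.inl ⟨j, ⟨0, (hI.simple j).length_pos⟩⟩, [])
  have hn₀ : n₀ ∈ T := hT.start _
  refine absco_mem_nhds_zero ⟨n₀, hn₀⟩ ?_
  set W := Submodule.span ℝ (I.vec '' (T : Set (Node I.P s))) with hW
  have hsub : I.polytope T ⊆ W := by
    intro y hy
    obtain ⟨c, rfl, -⟩ := exists_sum_of_mem_absco hy
    exact W.sum_mem fun n hn => W.smul_mem _ (Submodule.subset_span ⟨n, hn, rfl⟩)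
  have hinv : ∀ a, ∀ y ∈ W, I.B a *ᵥ y ∈ W := by
    intro a
    have : W ≤ W.comap (I.B a).mulVecLin := by
      rw [hW, Submodule.span_le]
      rintro _ ⟨n, hn, rfl⟩
      exact hsub (mulVec_mem_polytope hI hT a (vec_mem_polytope hn))
    exact this
  refine (hI.irreducible W hinv).resolve_left fun hbot => ?_
  have h0 : I.vec n₀ ∈ W := Submodule.subset_span ⟨n₀, hn₀, rfl⟩
  rw [hbot, Submodule.mem_bot] at h0
  rw [show I.vec n₀ = I.α j • I.v j from (vec_root j _).trans (rootVec_zero j)] at h0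
  exact (smul_ne_zero (hI.α_pos j).ne' (hI.v_ne_zero j)) h0

theorem absorbent_polytope : Absorbent ℝ (I.polytope T) :=
  absorbent_nhds_zero (polytope_mem_nhds_zero hI hT)

theorem gauge_lt_one_iff {y : Fin d → ℝ} :
    gauge (I.polytope T) y < 1 ↔ y ∈ interior (I.polytope T) :=
  gauge_lt_one_iff_mem_interior (convex_absco _) (polytope_mem_nhds_zero hI hT)

theorem gauge_wordProd_le (u : List (Fin m)) (y : Fin d → ℝ) :
    gauge (I.polytope T) (wordProd I.B u *ᵥ y) ≤ gauge (I.polytope T) y := by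
  induction u generalizing y with
  | nil => simp [wordProd_nil]
  | cons a u ih =>
    rw [wordProd_cons, ← Matrix.mulVec_mulVec]
    exact (ih _).trans (gauge_mulVec_le (absorbent_polytope hI hT)
      (fun y hy => mulVec_mem_polytope hI hT a hy) y)

/-- A path in the tree that does not begin with an edge of a root stays in a complete set until it
enters the interior of the polytope, and then stays in the interior. -/
theorem gauge_lt_one_or_mem (u : List (Fin m)) {n : Node I.P s} (hn : n ∈ T)
    (hu : ∀ a w, u = a :: w → ¬ I.IsRootEdge n a) :
    gauge (I.polytope T) (wordProd I.B u *ᵥ I.vec n) < 1 ∨ (n.1, n.2 ++ u) ∈ T := by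
  induction u generalizing n with
  | nil => right; simpa using hn
  | cons a u ih =>
    rw [wordProd_cons, ← Matrix.mulVec_mulVec]
    rcases hT.step n hn a with h | h | h
    · exact absurd h (hu a u rfl)
    · exact Or.inl ((gauge_wordProd_le hI hT u _).trans_lt ((gauge_lt_one_iff hI hT).2 h))
    · have := ih h fun b w _ hb => by
        obtain ⟨j, l, e, -⟩ := hb
        simp at e
      rw [vec_append_singleton] at this
      simpa using this

theorem gauge_lt_one_of_length {D : ℕ} (hD : ∀ n ∈ T, n.2.length < D) {u : List (Fin m)}
    (hl : D ≤ u.length) {n : Node I.P s} (hn : n ∈ T)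
    (hu : ∀ a w, u = a :: w → ¬ I.IsRootEdge n a) :
    gauge (I.polytope T) (wordProd I.B u *ᵥ I.vec n) < 1 := by
  refine (gauge_lt_one_or_mem hI hT u hn hu).resolve_right fun h => ?_
  have := hD _ h
  simp only [List.length_append] at this
  omega

/-- A path that leaves a root within `N` steps is in the interior of the polytope after `D` further
steps. -/
theorem gauge_wordProd_rootVec_lt_one {D : ℕ} (hD : ∀ n ∈ T, n.2.length < D) (N : ℕ) (j : Fin r)
    (i : ℕ) (u : List (Fin m)) (hl : N + D ≤ u.length)
    (hk : ∃ k < N, u[k]? ≠ cyclicLetter (I.P j) (i + k)) :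
    gauge (I.polytope T) (wordProd I.B u *ᵥ I.rootVec j i) < 1 := by
  induction N generalizing i u with
  | zero => obtain ⟨k, hk, -⟩ := hk; omega
  | succ N ih =>
    cases u with
    | nil => simp at hl
    | cons a u =>
      by_cases hc : cyclicLetter (I.P j) i = some a
      · rw [wordProd_cons, ← Matrix.mulVec_mulVec, mulVec_rootVec hI hc]
        refine ih _ _ (by simp at hl; omega) ?_
        obtain ⟨k, hk, hne⟩ := hk
        cases k with
        | zero => simp [hc] at hne
        | succ k =>
          refine ⟨k, by omega, ?_⟩
          rw [List.getElem?_cons_succ] at hne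
          rwa [add_assoc, add_comm 1 k]
      · have hlt := Nat.mod_lt i (hI.simple j).length_pos
        have h1 := gauge_lt_one_of_length hI hT hD (u := a :: u) (by omega)
          (hT.start (Sum.inl ⟨j, ⟨_, hlt⟩⟩)) fun b w e hb => by
            rw [isRootEdge_iff] at hb
            simp only [List.cons.injEq] at e
            apply hc
            rw [e.1, ← hb]
            simp [cyclicLetter]
        rw [vec_root] at h1
        simpa [rootVec] using h1

theorem exists_root_of_not_gauge_lt_one {D : ℕ} (hD : ∀ n ∈ T, n.2.length < D) (N : ℕ)
    (u : List (Fin m)) (hl : N + D ≤ u.length) {n : Node I.P s} (hn : n ∈ T)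
    (hg : ¬ gauge (I.polytope T) (wordProd I.B u *ᵥ I.vec n) < 1) :
    ∃ ρ, n = (Sum.inl ρ, []) ∧ ∀ k < N, u[k]? = cyclicLetter (I.P ρ.1) (ρ.2 + k) := by
  by_cases hr : ∃ ρ, n = (Sum.inl ρ, [])
  · obtain ⟨⟨j, l⟩, rfl⟩ := hr
    refine ⟨⟨j, l⟩, rfl, ?_⟩
    by_contra! hne
    rw [vec_root] at hg
    exact hg (gauge_wordProd_rootVec_lt_one hI hT hD N j l u hl hne)
  · refine absurd (gauge_lt_one_of_length hI hT hD (u := u) (by omega) hn ?_) hg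
    rintro a w - ⟨j, l, e, -⟩
    exact hr ⟨_, e⟩

/-- The length `M` is so large that, for each word of at least that length, at most one vertex of a
complete set is not sent to the interior of the polytope, and this vertex belongs to a root. Along
the powers of the `j`-th word, only the first vertex of the `j`-th root can survive. -/
theorem exists_survivor_length : ∃ M : ℕ,
    (∀ u : List (Fin m), M ≤ u.length → ∀ n ∈ T, ∀ n' ∈ T,
      ¬ gauge (I.polytope T) (wordProd I.B u *ᵥ I.vec n) < 1 →
      ¬ gauge (I.polytope T) (wordProd I.B u *ᵥ I.vec n') < 1 → n = n') ∧
    (∀ u : List (Fin m), M ≤ u.length → ∀ n ∈ T,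
      ¬ gauge (I.polytope T) (wordProd I.B u *ᵥ I.vec n) < 1 → ∃ ρ, n = (Sum.inl ρ, [])) ∧
    ∀ j, ∀ n ∈ T, n ≠ (Sum.inl ⟨j, ⟨0, (hI.simple j).length_pos⟩⟩, []) →
      gauge (I.polytope T) (wordProd I.B (I.P j) ^ M *ᵥ I.vec n) < 1 := by
  obtain ⟨N, hN⟩ := exists_separating_length hI.simple hI.not_isRotated
  obtain ⟨D, hD⟩ : ∃ D, ∀ n ∈ T, n.2.length < D :=
    ⟨T.sup (fun n => n.2.length) + 1, fun n hn =>
      Nat.lt_succ_of_le (Finset.le_sup (f := fun n : Node I.P s => n.2.length) hn)⟩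
  refine ⟨N + D, fun u hu n hn n' hn' hg hg' => ?_, fun u hu n hn hg => ?_, fun j n hn hne => ?_⟩
  · obtain ⟨ρ, rfl, h⟩ := exists_root_of_not_gauge_lt_one hI hT hD N u hu hn hg
    obtain ⟨τ, rfl, h'⟩ := exists_root_of_not_gauge_lt_one hI hT hD N u hu hn' hg'
    by_contra hne
    obtain ⟨k, hk, hkne⟩ := hN ρ τ fun e => hne (by rw [e])
    exact hkne ((h k hk).symm.trans (h' k hk))
  · obtain ⟨ρ, e, -⟩ := exists_root_of_not_gauge_lt_one hI hT hD N u hu hn hg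
    exact ⟨ρ, e⟩
  · by_contra hg
    have hpos := (hI.simple j).length_pos
    have hlen : N + D ≤ (N + D) * (I.P j).length := Nat.le_mul_of_pos_right _ hpos
    rw [← wordProd_replicate_flatten] at hg
    obtain ⟨ρ, rfl, h⟩ := exists_root_of_not_gauge_lt_one hI hT hD N _ (by simpa using hlen) hn hg
    obtain ⟨k, hk, hkne⟩ := hN ρ ⟨j, ⟨0, hpos⟩⟩ fun e => hne (by rw [e])
    rw [← h k hk, getElem?_flatten_replicate _ _ _ (by omega)] at hkne
    simp at hkne

end Complete

end Input

namespace Input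

variable {d m r s : ℕ} {I : Input d m r s}

theorem dotProduct_pow_mulVec {M : Matrix (Fin d) (Fin d) ℝ} {w : Fin d → ℝ} (hw : Mᵀ *ᵥ w = w)
    (k : ℕ) (y : Fin d → ℝ) : w ⬝ᵥ (M ^ k *ᵥ y) = w ⬝ᵥ y := by
  induction k with
  | zero => simp
  | succ k ih =>
    rw [pow_succ', ← Matrix.mulVec_mulVec, Matrix.dotProduct_mulVec, ← Matrix.mulVec_transpose, hw,
      ih]

section Complete

variable (hI : I.Admissible) {T : Finset (Node I.P s)} (hT : I.IsComplete T)

include hI hT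

/-! ### The adjoint leading eigenvectors -/

/-- An eigenvector of the adjoint of the `j`-th product attains its maximum over the polytope only
at the first vertex of the `j`-th root, since a power of the product takes the other vertices to the
interior. -/
theorem abs_dotProduct_vec_lt {j : Fin r} {w : Fin d → ℝ}
    (hw : (wordProd I.B (I.P j))ᵀ *ᵥ w = w) (hw0 : w ≠ 0) :
    ∀ n ∈ T, n ≠ (Sum.inl ⟨j, ⟨0, (hI.simple j).length_pos⟩⟩, []) →
      |w ⬝ᵥ I.vec n| < |w ⬝ᵥ I.rootVec j 0| := by
  obtain ⟨M, -, -, hM⟩ := exists_survivor_length hI hT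
  have habs := absorbent_polytope hI hT
  set n₀ : Node I.P s := (Sum.inl ⟨j, ⟨0, (hI.simple j).length_pos⟩⟩, []) with hn₀
  have hn₀T : n₀ ∈ T := hT.start _
  have hvec : I.vec n₀ = I.rootVec j 0 := vec_root _ _
  obtain ⟨n₁, hn₁, hmax⟩ := T.exists_max_image (fun n => |w ⬝ᵥ I.vec n|) ⟨n₀, hn₀T⟩
  set c := |w ⬝ᵥ I.vec n₁| with hc
  have hle : ∀ y, |w ⬝ᵥ y| ≤ c * gauge (I.polytope T) y :=
    abs_dotProduct_le_mul_gauge habs (abs_nonneg _) hmax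
  have hcpos : 0 < c := by
    refine (abs_nonneg _).lt_of_ne fun h0 => hw0 ?_
    rw [← dotProduct_self_eq_zero]
    have := hle w
    rw [hc, ← h0, zero_mul] at this
    exact abs_nonpos_iff.1 this
  have hlt : ∀ n ∈ T, n ≠ n₀ → |w ⬝ᵥ I.vec n| < c := fun n hn hne => by
    rw [← dotProduct_pow_mulVec hw M]
    exact (hle _).trans_lt (mul_lt_of_lt_one_right hcpos (hM j n hn hne))
  have he : n₁ = n₀ := by
    by_contra hne
    exact lt_irrefl _ (hlt n₁ hn₁ hne)
  rwa [hc, he, hvec] at hlt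

theorem dotProduct_v_ne_zero {j : Fin r} {w : Fin d → ℝ}
    (hw : (wordProd I.B (I.P j))ᵀ *ᵥ w = w) (hw0 : w ≠ 0) : w ⬝ᵥ I.v j ≠ 0 := by
  intro h0
  have hr : w ⬝ᵥ I.rootVec j 0 = 0 := by rw [rootVec_zero, dotProduct_smul, h0, smul_zero]
  have hlt := abs_dotProduct_vec_lt hI hT hw hw0
  have hle : ∀ n ∈ T, |w ⬝ᵥ I.vec n| ≤ 0 := fun n hn => by
    by_cases hne : n = (Sum.inl ⟨j, ⟨0, (hI.simple j).length_pos⟩⟩, [])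
    · rw [hne, vec_root, hr, abs_zero]
    · have := hlt n hn hne
      rw [hr, abs_zero] at this
      exact this.le
  have := abs_dotProduct_le_mul_gauge (absorbent_polytope hI hT) le_rfl hle w
  rw [zero_mul] at this
  exact hw0 (dotProduct_self_eq_zero.1 (abs_nonpos_iff.1 this))

theorem existsUnique_isAdjointEigenvector (j : Fin r) :
    ∃! w, IsAdjointEigenvector (wordProd I.B (I.P j)) (I.v j) w := by
  set M := wordProd I.B (I.P j) with hM
  have hdet : (M - 1).det = 0 := Matrix.exists_mulVec_eq_zero_iff.1
    ⟨I.v j, hI.v_ne_zero j, by rw [Matrix.sub_mulVec, hI.eigen j, Matrix.one_mulVec, sub_self]⟩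
  rw [← Matrix.det_transpose] at hdet
  obtain ⟨w, hw0, hw⟩ := Matrix.exists_mulVec_eq_zero_iff.2 hdet
  rw [Matrix.transpose_sub, Matrix.transpose_one, Matrix.sub_mulVec, Matrix.one_mulVec,
    sub_eq_zero] at hw
  have hne := dotProduct_v_ne_zero hI hT hw hw0
  refine ⟨(w ⬝ᵥ I.v j)⁻¹ • w, ⟨?_, ?_⟩, ?_⟩
  · rw [Matrix.mulVec_smul, hw]
  · rw [smul_dotProduct, smul_eq_mul, inv_mul_cancel₀ hne]
  · rintro w' ⟨h1, h2⟩
    set z := (w ⬝ᵥ I.v j)⁻¹ • w with hz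
    by_contra hne'
    refine dotProduct_v_ne_zero hI hT (j := j) (w := w' - z) ?_ (sub_ne_zero.2 hne') ?_
    · rw [← hM, Matrix.mulVec_sub, h1, hz, Matrix.mulVec_smul, hw]
    · rw [sub_dotProduct, h2, hz, smul_dotProduct, smul_eq_mul, inv_mul_cancel₀ hne, sub_self]

section Adjoint

variable {j : Fin r} {w : Fin d → ℝ}
  (hw : IsAdjointEigenvector (wordProd I.B (I.P j)) (I.v j) w)

include hw

theorem abs_dotProduct_vec_lt_α {n : Node I.P s} (hn : n ∈ T)
    (hne : n ≠ (Sum.inl ⟨j, ⟨0, (hI.simple j).length_pos⟩⟩, [])) : |w ⬝ᵥ I.vec n| < I.α j := by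
  have hw0 : w ≠ 0 := by
    rintro rfl
    simpa using hw.2
  have h := abs_dotProduct_vec_lt hI hT hw.1 hw0 n hn hne
  rwa [rootVec_zero, dotProduct_smul, hw.2, smul_eq_mul, mul_one, abs_of_pos (hI.α_pos j)] at h

theorem abs_dotProduct_le_α_mul_gauge (y : Fin d → ℝ) :
    |w ⬝ᵥ y| ≤ I.α j * gauge (I.polytope T) y := by
  refine abs_dotProduct_le_mul_gauge (absorbent_polytope hI hT) (hI.α_pos j).le (fun n hn => ?_) y
  by_cases hne : n = (Sum.inl ⟨j, ⟨0, (hI.simple j).length_pos⟩⟩, [])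
  · rw [hne, vec_root, rootVec_zero, dotProduct_smul, hw.2, smul_eq_mul, mul_one,
      abs_of_pos (hI.α_pos j)]
  · exact (abs_dotProduct_vec_lt_α hI hT hw hn hne).le

/-! ### Necessity of the criterion -/

/-- If the algorithm halts, the values of the adjoint eigenvector along the orbit of an extra vertex
`x i` are bounded away from `α j`: finitely many of them occur at vertices of the tree, which are
different from the vertices of the root, and the others in a smaller multiple of the polytope. -/
theorem q_lt_of_isComplete (i : Fin s) : q I.B w (I.x i) < ENNReal.ofReal (I.α j) := by
  have hα := hI.α_pos j
  obtain ⟨D, hD⟩ : ∃ D, ∀ n ∈ T, n.2.length < D :=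
    ⟨T.sup (fun n => n.2.length) + 1, fun n hn =>
      Nat.lt_succ_of_le (Finset.le_sup (f := fun n : Node I.P s => n.2.length) hn)⟩
  have hxT : ((Sum.inr i, []) : Node I.P s) ∈ T := hT.start _
  have hxv : I.vec (Sum.inr i, []) = I.x i := by simp [vec, startVec, wordProd_nil]
  have hnr : ∀ a, ¬ I.IsRootEdge (Sum.inr i, []) a := by
    rintro a ⟨j, l, e, -⟩
    simp at e
  obtain ⟨c₁, -, hc₁, h₁⟩ := exists_bound_lt_one (List.finite_length_le (Fin m) D)
    (fun u => |w ⬝ᵥ (wordProd I.B u *ᵥ I.x i)| / I.α j) fun u _ => by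
      rw [div_lt_one hα]
      have h := gauge_lt_one_or_mem hI hT u hxT fun a _ _ => hnr a
      rw [hxv] at h
      rcases h with h | h
      · exact (abs_dotProduct_le_α_mul_gauge hI hT hw _).trans_lt (mul_lt_of_lt_one_right hα h)
      · have h2 := abs_dotProduct_vec_lt_α hI hT hw h (by simp)
        have h3 := vec_append (I := I) (Sum.inr i, []) u
        rw [hxv] at h3
        rwa [h3] at h2
  obtain ⟨c₂, -, hc₂, h₂⟩ := exists_bound_lt_one (List.finite_length_eq (Fin m) D)
    (fun u => gauge (I.polytope T) (wordProd I.B u *ᵥ I.x i)) fun u hu => by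
      have h := gauge_lt_one_of_length hI hT hD (ge_of_eq hu) hxT fun a _ _ => hnr a
      rwa [hxv] at h
  have hq : q I.B w (I.x i) ≤ ENNReal.ofReal (max c₁ c₂ * I.α j) := by
    refine iSup_le fun u => ENNReal.ofReal_le_ofReal ?_
    by_cases hu : u.length ≤ D
    · have := h₁ u hu
      rw [div_le_iff₀ hα] at this
      exact this.trans (by gcongr; exact le_max_left _ _)
    · refine (abs_dotProduct_le_α_mul_gauge hI hT hw _).trans ?_
      rw [mul_comm]
      gcongr
      refine le_trans ?_ ((h₂ (u.take D) (by simp; omega)).trans (le_max_right _ _))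
      nth_rewrite 1 [← List.take_append_drop D u]
      rw [wordProd_append, ← Matrix.mulVec_mulVec]
      exact gauge_wordProd_le hI hT _ _
  refine hq.trans_lt ((ENNReal.ofReal_lt_ofReal_iff hα).2 ?_)
  exact mul_lt_of_lt_one_left hα (max_lt hc₁ hc₂)

/-! ### Sufficiency of the criterion -/

/-- A root vertex has a coefficient of modulus at most `(1 + θ) / 2` (relative to the gauge) in a
shortest representation of a point whose orbit has adjoint values at most `θ * α j`: the word that
closes the root takes this vertex to the maximum of the adjoint eigenvector, and the other terms
cannot compensate a larger coefficient. -/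
theorem abs_coeff_root_le {θ : ℝ} (hθ : 0 ≤ θ) {y : Fin d → ℝ}
    (hy : ∀ u, |w ⬝ᵥ (wordProd I.B u *ᵥ y)| ≤ θ * I.α j) (l : Fin (I.P j).length)
    {c : Node I.P s → ℝ} (hc : y = ∑ n ∈ T, c n • I.vec n) {G : ℝ} (hG : 1 ≤ G)
    (hcG : ∑ n ∈ T, |c n| ≤ G) : |c (Sum.inl ⟨j, l⟩, [])| ≤ (1 + θ) / 2 * G := by
  classical
  have hα := hI.α_pos j
  set n₀ : Node I.P s := (Sum.inl ⟨j, l⟩, []) with hn₀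
  have hn₀T : n₀ ∈ T := hT.start _
  set e := (I.P j).drop l with he
  have h1 : w ⬝ᵥ (wordProd I.B e *ᵥ I.vec n₀) = I.α j := by
    have : wordProd I.B e * wordProd I.B ((I.P j).take l) = wordProd I.B (I.P j) := by
      rw [← wordProd_append, List.take_append_drop]
    rw [hn₀, vec_root, rootVec, Nat.mod_eq_of_lt l.2, Matrix.mulVec_smul, Matrix.mulVec_mulVec, this,
      hI.eigen j, dotProduct_smul, hw.2, smul_eq_mul, mul_one]
  have h2 : ∀ n ∈ T, |w ⬝ᵥ (wordProd I.B e *ᵥ I.vec n)| ≤ I.α j := fun n hn => by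
    refine (abs_dotProduct_le_α_mul_gauge hI hT hw _).trans (mul_le_of_le_one_right hα.le ?_)
    exact (gauge_wordProd_le hI hT _ _).trans (gauge_le_one_of_mem (vec_mem_polytope hn))
  have h3 : w ⬝ᵥ (wordProd I.B e *ᵥ y) = c n₀ * I.α j +
      ∑ n ∈ T.erase n₀, c n * (w ⬝ᵥ (wordProd I.B e *ᵥ I.vec n)) := by
    rw [hc, ← h1, Finset.add_sum_erase T (fun n => c n * (w ⬝ᵥ (wordProd I.B e *ᵥ I.vec n))) hn₀T,
      Matrix.mulVec_sum, dotProduct_sum]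
    simp only [Matrix.mulVec_smul, dotProduct_smul, smul_eq_mul]
  have h4 : |∑ n ∈ T.erase n₀, c n * (w ⬝ᵥ (wordProd I.B e *ᵥ I.vec n))| ≤
      (∑ n ∈ T.erase n₀, |c n|) * I.α j := by
    rw [Finset.sum_mul]
    refine (Finset.abs_sum_le_sum_abs _ _).trans (Finset.sum_le_sum fun n hn => ?_)
    rw [abs_mul]
    exact mul_le_mul_of_nonneg_left (h2 n (Finset.mem_of_mem_erase hn)) (abs_nonneg _)
  have h5 := hy e
  rw [h3] at h5
  have h6 : |c n₀| * I.α j ≤ θ * I.α j + (∑ n ∈ T.erase n₀, |c n|) * I.α j := by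
    rw [← abs_of_pos hα, ← abs_mul, abs_of_pos hα]
    calc |c n₀ * I.α j| = |(c n₀ * I.α j +
            ∑ n ∈ T.erase n₀, c n * (w ⬝ᵥ (wordProd I.B e *ᵥ I.vec n))) -
            ∑ n ∈ T.erase n₀, c n * (w ⬝ᵥ (wordProd I.B e *ᵥ I.vec n))| := by
          rw [add_sub_cancel_right]
      _ ≤ _ := (abs_sub _ _).trans (add_le_add h5 h4)
  have h7 : |c n₀| ≤ θ + ∑ n ∈ T.erase n₀, |c n| := by
    rw [← add_mul] at h6
    exact le_of_mul_le_mul_right h6 hα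
  have h8 := Finset.add_sum_erase T (fun n => |c n|) hn₀T
  nlinarith

end Adjoint

/-- If, for every `j`, the adjoint values along the orbit of `x` are at most `θ * α j` with a
common `θ < 1`, then all sufficiently long words take `x` to the interior of the polytope. -/
theorem exists_length_gauge_lt_one {w : Fin r → Fin d → ℝ}
    (hw : ∀ j, IsAdjointEigenvector (wordProd I.B (I.P j)) (I.v j) (w j)) {θ : ℝ} (hθ : 0 ≤ θ)
    (hθ1 : θ < 1) {x : Fin d → ℝ} (hx : ∀ j u, |w j ⬝ᵥ (wordProd I.B u *ᵥ x)| ≤ θ * I.α j) :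
    ∃ L, ∀ u : List (Fin m), L ≤ u.length → gauge (I.polytope T) (wordProd I.B u *ᵥ x) < 1 := by
  classical
  obtain ⟨M, hM1, hM2, -⟩ := exists_survivor_length hI hT
  have habs := absorbent_polytope hI hT
  have hfin : {p : List (Fin m) × Node I.P s | (p.1.length = M ∧ p.2 ∈ T) ∧
      gauge (I.polytope T) (wordProd I.B p.1 *ᵥ I.vec p.2) < 1}.Finite :=
    ((List.finite_length_eq (Fin m) M).prod T.finite_toSet).subset fun p hp => hp.1
  obtain ⟨κ, hκ0, hκ1, hκ⟩ := exists_bound_lt_one hfin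
    (fun p => gauge (I.polytope T) (wordProd I.B p.1 *ᵥ I.vec p.2)) fun p hp => hp.2
  set μ := (1 + θ) / 2 + κ * ((1 - θ) / 2) with hμ
  have hμ0 : 0 ≤ μ := by
    have : 0 ≤ κ * ((1 - θ) / 2) := mul_nonneg hκ0 (by linarith)
    linarith
  have hμ1 : μ < 1 := by nlinarith
  -- words of length `M` contract the points of the orbit that are outside the interior
  have hstep : ∀ (y : Fin d → ℝ), (∀ j u, |w j ⬝ᵥ (wordProd I.B u *ᵥ y)| ≤ θ * I.α j) →
      1 ≤ gauge (I.polytope T) y → ∀ u : List (Fin m), u.length = M →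
      gauge (I.polytope T) (wordProd I.B u *ᵥ y) ≤ μ * gauge (I.polytope T) y := by
    intro y hy hg u hu
    obtain ⟨c, hc, hcG⟩ := exists_sum_of_one_le_gauge (polytope_mem_nhds_zero hI hT) hg
    change _ ≤ gauge (I.polytope T) y at hcG
    set G := gauge (I.polytope T) y with hG
    have hle : gauge (I.polytope T) (wordProd I.B u *ᵥ y) ≤
        ∑ n ∈ T, |c n| * gauge (I.polytope T) (wordProd I.B u *ᵥ I.vec n) := by
      rw [hc, Matrix.mulVec_sum]
      simp only [Matrix.mulVec_smul]
      exact gauge_sum_smul_le habs (convex_absco _) (balanced_absco _) T c _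
    refine hle.trans ?_
    by_cases hall : ∀ n ∈ T, gauge (I.polytope T) (wordProd I.B u *ᵥ I.vec n) < 1
    · calc ∑ n ∈ T, |c n| * gauge (I.polytope T) (wordProd I.B u *ᵥ I.vec n)
          ≤ ∑ n ∈ T, |c n| * κ := Finset.sum_le_sum fun n hn =>
            mul_le_mul_of_nonneg_left (hκ (u, n) ⟨⟨hu, hn⟩, hall n hn⟩) (abs_nonneg _)
        _ = κ * ∑ n ∈ T, |c n| := by rw [← Finset.sum_mul, mul_comm]
        _ ≤ κ * G := by gcongr
        _ ≤ μ * G := by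
          gcongr
          nlinarith
    · push Not at hall
      obtain ⟨n₀, hn₀, hn₀g⟩ := hall
      obtain ⟨⟨j, l⟩, e⟩ := hM2 u hu.ge n₀ hn₀ hn₀g.not_gt
      have hc0 : |c n₀| ≤ (1 + θ) / 2 * G := by
        rw [e]
        exact abs_coeff_root_le hI hT (hw j) hθ (hy j) l hc hg hcG
      have hsum := Finset.add_sum_erase T (fun n => |c n|) hn₀
      have h1 : gauge (I.polytope T) (wordProd I.B u *ᵥ I.vec n₀) ≤ 1 :=
        (gauge_wordProd_le hI hT _ _).trans (gauge_le_one_of_mem (vec_mem_polytope hn₀))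
      have h2 : ∑ n ∈ T.erase n₀, |c n| * gauge (I.polytope T) (wordProd I.B u *ᵥ I.vec n) ≤
          (∑ n ∈ T.erase n₀, |c n|) * κ := by
        rw [Finset.sum_mul]
        refine Finset.sum_le_sum fun n hn => mul_le_mul_of_nonneg_left ?_ (abs_nonneg _)
        have hnT := Finset.mem_of_mem_erase hn
        refine hκ (u, n) ⟨⟨hu, hnT⟩, ?_⟩
        by_contra hng
        exact Finset.ne_of_mem_erase hn (hM1 u hu.ge n hnT n₀ hn₀ hng hn₀g.not_gt)
      rw [← Finset.add_sum_erase T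
        (fun n => |c n| * gauge (I.polytope T) (wordProd I.B u *ᵥ I.vec n)) hn₀]
      calc |c n₀| * gauge (I.polytope T) (wordProd I.B u *ᵥ I.vec n₀) +
            ∑ n ∈ T.erase n₀, |c n| * gauge (I.polytope T) (wordProd I.B u *ᵥ I.vec n)
          ≤ |c n₀| * 1 + (G - |c n₀|) * κ := by
            refine add_le_add (mul_le_mul_of_nonneg_left h1 (abs_nonneg _)) (h2.trans ?_)
            exact mul_le_mul_of_nonneg_right (by linarith) hκ0
        _ = |c n₀| * (1 - κ) + G * κ := by ring
        _ ≤ (1 + θ) / 2 * G * (1 - κ) + G * κ := by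
            have := mul_le_mul_of_nonneg_right hc0 (sub_nonneg.2 hκ1.le)
            linarith
        _ = μ * G := by rw [hμ]; ring
  have hiter : ∀ k, ∀ y, (∀ j u, |w j ⬝ᵥ (wordProd I.B u *ᵥ y)| ≤ θ * I.α j) →
      ∀ u : List (Fin m), k * M ≤ u.length →
      gauge (I.polytope T) (wordProd I.B u *ᵥ y) < 1 ∨
      gauge (I.polytope T) (wordProd I.B u *ᵥ y) ≤ μ ^ k * gauge (I.polytope T) y := by
    intro k
    induction k with
    | zero => intro y _ u _; right; simpa using gauge_wordProd_le hI hT u y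
    | succ k ih =>
      intro y hy u hu
      rw [Nat.succ_mul] at hu
      by_cases hg : gauge (I.polytope T) y < 1
      · exact Or.inl ((gauge_wordProd_le hI hT u y).trans_lt hg)
      have h1 := hstep y hy (not_lt.1 hg) (u.take M) (by simp; omega)
      have h2 := ih (wordProd I.B (u.take M) *ᵥ y) (fun j u' => by
        rw [Matrix.mulVec_mulVec, ← wordProd_append]; exact hy j _) (u.drop M) (by simp; omega)
      rw [Matrix.mulVec_mulVec, ← wordProd_append, List.take_append_drop] at h2
      refine h2.imp id fun h => h.trans ?_
      rw [pow_succ, mul_assoc]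
      gcongr
  obtain ⟨k, hk⟩ : ∃ k : ℕ, μ ^ k * gauge (I.polytope T) x < 1 := by
    have h := (tendsto_pow_atTop_nhds_zero_of_lt_one hμ0 hμ1).mul_const (gauge (I.polytope T) x)
    rw [zero_mul] at h
    exact (h.eventually (gt_mem_nhds one_pos)).exists
  exact ⟨k * M, fun u hu => (hiter k x hx u hu).elim id fun h => h.trans_lt hk⟩

end Complete

/-! ### Comparison of runs with and without extra vertices -/

theorem IsRun.mulVec_mem_polytope_succ (hI : I.Admissible) {V R : ℕ → Finset (Node I.P s)}
    (h : I.IsRun V R) (k : ℕ) (a : Fin m) {y : Fin d → ℝ} (hy : y ∈ I.polytope (V k)) :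
    I.B a *ᵥ y ∈ I.polytope (V (k + 1)) := by
  refine mulVec_mem_absco ?_ hy
  rintro _ ⟨n, hn, rfl⟩
  obtain ⟨l, hl, hnl⟩ := h.exists_mem_new k n hn
  have hmono := h.mono (Nat.succ_le_succ hl)
  rcases h.step l n hnl a with h1 | h1 | h1
  · exact mulVec_mem_of_isRootEdge hI
      (fun σ => h.mono (Nat.zero_le _) (by rw [h.1]; exact mem_initial σ)) h1
  · exact polytope_mono hmono (interior_subset h1)
  · have := vec_mem_polytope (hmono h1)
    rwa [vec_append_singleton] at this

theorem IsRun.vec_mem_polytope (hI : I.Admissible) {V R : ℕ → Finset (Node I.P s)}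
    (h : I.IsRun V R) (n : Node I.P s) : I.vec n ∈ I.polytope (V n.2.length) := by
  obtain ⟨σ, u⟩ := n
  induction u using List.reverseRecOn with
  | nil =>
    refine Input.vec_mem_polytope ?_
    rw [List.length_nil, h.1]
    exact mem_initial σ
  | append_singleton u a ih =>
    have := h.mulVec_mem_polytope_succ hI _ a ih
    rw [← vec_append_singleton] at this
    simpa using this

end Input

/-- If the adjoint values along the orbits of the extra vertices are at most `θ * α j` with
`θ < 1`, and the algorithm halts without extra vertices, then it halts with them. -/
theorem halts_of_bound {d m r s : ℕ} {B : Fin m → Matrix (Fin d) (Fin d) ℝ}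
    {P : Fin r → List (Fin m)} {v : Fin r → Fin d → ℝ} {α : Fin r → ℝ} {x : Fin s → Fin d → ℝ}
    (hI₀ : Input.Admissible (⟨B, P, v, α, ![]⟩ : Input d m r 0))
    (hI : Input.Admissible (⟨B, P, v, α, x⟩ : Input d m r s))
    {T₀ : Finset (Node P 0)} (hT₀ : Input.IsComplete ⟨B, P, v, α, ![]⟩ T₀)
    {w : Fin r → Fin d → ℝ} (hw : ∀ j, IsAdjointEigenvector (wordProd B (P j)) (v j) (w j))
    {θ : ℝ} (hθ : 0 ≤ θ) (hθ1 : θ < 1)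
    (hx : ∀ i j u, |w j ⬝ᵥ (wordProd B u *ᵥ x i)| ≤ θ * α j)
    {V R : ℕ → Finset (Node P s)} (hrun : Input.IsRun ⟨B, P, v, α, x⟩ V R) : Halts R := by
  set I₀ : Input d m r 0 := ⟨B, P, v, α, ![]⟩ with hI₀'
  set I : Input d m r s := ⟨B, P, v, α, x⟩ with hI'
  obtain ⟨D, hD⟩ : ∃ D, ∀ n ∈ T₀, n.2.length < D :=
    ⟨T₀.sup (fun n => n.2.length) + 1, fun n hn =>
      Nat.lt_succ_of_le (Finset.le_sup (f := fun n : Node P 0 => n.2.length) hn)⟩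
  -- after `D` iterations the polytope contains the final polytope of the run without extra vertices
  have hsub : I₀.polytope T₀ ⊆ I.polytope (V D) := by
    have hvec : I₀.vec '' (T₀ : Set (Node P 0)) ⊆ I.polytope (V D) := by
      rintro _ ⟨⟨ρ | i, u⟩, hn, rfl⟩
      · exact Input.polytope_mono (hrun.mono (hD _ hn).le)
          (hrun.vec_mem_polytope hI (Sum.inl ρ, u))
      · exact i.elim0
    intro y hy
    have h1 := mulVec_mem_absco (M := 1) (S' := I.vec '' (V D : Set (Node P s)))
      (fun z hz => by rw [Matrix.one_mulVec]; exact hvec hz) hy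
    rwa [Matrix.one_mulVec] at h1
  choose L hL using fun i => Input.exists_length_gauge_lt_one hI₀ hT₀ hw hθ hθ1 (hx i)
  set K := D + Finset.univ.sup L with hK
  refine ⟨K + 1, Finset.eq_empty_of_forall_notMem fun n hn => ?_⟩
  obtain ⟨hlen, hroot⟩ := hrun.length_eq (K + 1) n hn
  obtain ⟨-, -, -, -, -, hint⟩ := hrun.new K n hn
  refine hint (interior_mono (hsub.trans (Input.polytope_mono
    (hrun.mono (Nat.le_add_right D _)))) ((Input.gauge_lt_one_iff hI₀ hT₀).1 ?_))
  obtain ⟨⟨j, l⟩ | i, u⟩ := n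
  · have h1 := Input.gauge_lt_one_of_length hI₀ hT₀ hD (u := u)
      (n := (Sum.inl ⟨j, l⟩, [])) (by simp only at hlen; omega) (hT₀.start _) fun a u' e hr => by
        refine hroot a u' e ?_
        rw [Input.isRootEdge_iff] at hr ⊢
        exact hr
    rw [← Input.vec_append] at h1
    exact h1
  · have h1 := hL i u (by
      have := Finset.le_sup (f := L) (Finset.mem_univ i)
      simp only at hlen
      omega)
    exact h1

theorem isIrreducibleFamily_normalized {d m : ℕ} {A : Fin m → Matrix (Fin d) (Fin d) ℝ}
    (hA : IsIrreducibleFamily A) {c : ℝ} (hc : c ≠ 0) : IsIrreducibleFamily (normalized c A) := by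
  intro W hW
  refine hA W fun i y hy => ?_
  have h := W.smul_mem c (hW i y hy)
  rwa [normalized, Matrix.smul_mulVec, smul_inv_smul₀ hc] at h

theorem exists_bound_of_q_lt {d m r s : ℕ} {B : Fin m → Matrix (Fin d) (Fin d) ℝ}
    {w : Fin r → Fin d → ℝ} {α : Fin r → ℝ} (hα : ∀ j, 0 < α j) {x : Fin s → Fin d → ℝ}
    (h : ∀ j i, q B (w j) (x i) < ENNReal.ofReal (α j)) :
    ∃ θ, 0 ≤ θ ∧ θ < 1 ∧ ∀ i j u, |w j ⬝ᵥ (wordProd B u *ᵥ x i)| ≤ θ * α j := by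
  obtain ⟨θ, h0, h1, hθ⟩ := exists_bound_lt_one (Set.finite_univ (α := Fin r × Fin s))
    (fun p => (q B (w p.1) (x p.2)).toReal / α p.1) fun p _ => by
      rw [div_lt_one (hα p.1)]
      exact (ENNReal.lt_ofReal_iff_toReal_lt (h p.1 p.2).ne_top).1 (h p.1 p.2)
  refine ⟨θ, h0, h1, fun i j u => ?_⟩
  have h2 := hθ (j, i) (Set.mem_univ _)
  rw [div_le_iff₀ (hα j)] at h2
  refine le_trans ?_ h2
  rw [← ENNReal.ofReal_le_iff_le_toReal (h j i).ne_top]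
  exact le_iSup (fun u : List (Fin m) => ENNReal.ofReal |w j ⬝ᵥ (wordProd B u *ᵥ x i)|) u

end InvariantPolytope

theorem theorem3 {d m r s : ℕ} (hr : 0 < r)
    -- an irreducible family
    (A : Fin m → Matrix (Fin d) (Fin d) ℝ) (hA : IsIrreducibleFamily A)
    -- the candidates: simple products, different up to cyclic permutations, with equal averaged
    -- spectral radii
    (P : Fin r → List (Fin m)) (hsimple : ∀ j, IsSimpleWord (P j))
    (hdiff : ∀ i j, i ≠ j → ¬ (P i).IsRotated (P j))
    (ρc : ℝ) (hρ : ∀ j, specRad (wordProd A (P j)) ^ (1 / ((P j).length : ℝ)) = ρc)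
    -- leading eigenvectors of the normalized products, with leading eigenvalue one
    (v : Fin r → Fin d → ℝ) (hv0 : ∀ j, v j ≠ 0)
    (hv : ∀ j, wordProd (normalized ρc A) (P j) *ᵥ v j = v j)
    -- balancing multipliers and extra initial vertices
    (α : Fin r → ℝ) (hα : ∀ j, 0 < α j) (x : Fin s → Fin d → ℝ)
    -- the algorithm without extra vertices halts
    (V₀ R₀ : ℕ → Finset (Node P 0))
    (hrun : Input.IsRun ⟨normalized ρc A, P, v, α, ![]⟩ V₀ R₀) (hhalt : Halts R₀) :
    -- the normalized adjoint leading eigenvectors exist and are unique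
    (∀ j, ∃! w, IsAdjointEigenvector (wordProd (normalized ρc A) (P j)) (v j) w) ∧
    -- and the algorithm with the extra vertices halts if and only if the criterion holds
    ∀ vs : Fin r → Fin d → ℝ,
      (∀ j, IsAdjointEigenvector (wordProd (normalized ρc A) (P j)) (v j) (vs j)) →
      ∀ V R : ℕ → Finset (Node P s), Input.IsRun ⟨normalized ρc A, P, v, α, x⟩ V R →
        (Halts R ↔ ∀ j i, q (normalized ρc A) (vs j) (x i) < ENNReal.ofReal (α j)) := by
  have hρ0 : ρc ≠ 0 := by
    rintro rfl
    -- a vanishing normalized family would have no eigenvector for the eigenvalue `1`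
    have hP := (hsimple ⟨0, hr⟩).1
    apply hv0 ⟨0, hr⟩
    rw [← hv ⟨0, hr⟩]
    obtain ⟨a, u, e⟩ := List.exists_cons_of_ne_nil hP
    rw [e, wordProd_cons]
    simp [normalized]
  have hI : ∀ (s : ℕ) (x : Fin s → Fin d → ℝ),
      Input.Admissible (⟨normalized ρc A, P, v, α, x⟩ : Input d m r s) := fun s x =>
    ⟨hr, isIrreducibleFamily_normalized hA hρ0, hsimple, hdiff, hv0, hv, hα⟩
  obtain ⟨k, hk⟩ := hhalt
  have hT₀ := hrun.isComplete hk
  refine ⟨Input.existsUnique_isAdjointEigenvector (hI 0 _) hT₀, fun vs hvs V R hR => ⟨?_, ?_⟩⟩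
  · rintro ⟨k', hk'⟩ j i
    exact Input.q_lt_of_isComplete (hI s x) (hR.isComplete hk') (hvs j) i
  · intro hq
    obtain ⟨θ, h0, h1, hθ⟩ := exists_bound_of_q_lt hα hq
    exact halts_of_bound (hI 0 _) (hI s x) hT₀ hvs h0 h1 hθ hR
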